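/- Let $\mathbb{R}^3_1$ be Minkowski 3-space, i.e. $\mathbb{R}^3$ with the pseudo-scalar product $\langle u,v\rangle=u_0v_0+u_1v_1-u_2v_2$, and let $LC=\{p:\langle p,p\rangle=0\}$ be its light cone. The Möbius inversion of a closed subset $F\subset\mathbb{R}^3_1$ is $$i_M(F)=\operatorname{cl}\left\{\frac{p}{\langle p,p\rangle} : p\in F\setminus LC\right\},$$ where $\operatorname{cl}$ is the closure in the usual topology of $\mathbb{R}^3$. A closed surface in $\mathbb{R}^3_1$ is a compact connected smooth regular (embedded) surface without boundary. It is an ovaloid if at every point $p$ it has contact $A_1^+$ with its tangent plane $T_pS$, that is, the height function $q\mapsto\langle n,q-p\rangle$ on $S$, where $n\neq 0$ is normal to $T_pS$, has at $p$ a Morse singularity of index $0$ or $2$. Theorem. For every ovaloid $S\subset\mathbb{R}^3_1$ there is a translation $T:\mathbb{R}^3_1\to\mathbb{R}^3_1$ such that $i_M(T(S))$ is an ovaloid. -/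

import Mathlib

open scoped ContDiff

noncomputable section

namespace Minkowski

/-- The parameter plane. -/
abbrev Plane : Type := EuclideanSpace ℝ (Fin 2)

/-- The underlying space `ℝ³` of Minkowski 3-space, with its usual topology and smooth structure. -/
abbrev Space : Type := EuclideanSpace ℝ (Fin 3)

/-- The pseudo-scalar product `⟨u, v⟩ = u₀ v₀ + u₁ v₁ - u₂ v₂`. -/
def form (u v : Space) : ℝ := u 0 * v 0 + u 1 * v 1 - u 2 * v 2

/-- The light cone: all points `p` with `⟨p, p⟩ = 0` (the origin included). -/
def lightCone : Set Space := {p | form p p = 0}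

/-- The Möbius inversion `cl {p / ⟨p, p⟩ : p ∈ F ∖ LC}` of a subset `F`. -/
def mobiusInversion (F : Set Space) : Set Space :=
  closure ((fun p : Space => (form p p)⁻¹ • p) '' (F \ lightCone))

/-- `x : U → ℝ³` is a local parametrization of `S`: it is smooth on the open set `U`, it has
injective differential at every point of `U`, and it is a homeomorphism of `U` onto a relatively
open subset of `S`. -/
structure IsLocalParametrization (S : Set Space) (U : Set Plane) (x : Plane → Space) : Prop where
  isOpen_domain : IsOpen U
  contDiffOn : ContDiffOn ℝ ∞ x U
  injective_fderiv : ∀ u ∈ U, Function.Injective (fderiv ℝ x u)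
  isEmbedding : Topology.IsEmbedding (U.domRestrict x)
  image_eq : ∃ V : Set Space, IsOpen V ∧ x '' U = S ∩ V

/-- A smooth regular surface (without boundary) in `ℝ³`. -/
def IsRegularSurface (S : Set Space) : Prop :=
  ∀ p ∈ S, ∃ (U : Set Plane) (x : Plane → Space), IsLocalParametrization S U x ∧ p ∈ x '' U

/-- A closed surface: a compact connected regular surface (without boundary).
`IsConnected` includes nonemptiness. -/
def IsClosedSurface (S : Set Space) : Prop :=
  IsRegularSurface S ∧ IsCompact S ∧ IsConnected S

/-- The Hessian of `f` at `u`, as the second derivative. It is only used for functions that are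
smooth near `u`. -/
def hessian (f : Plane → ℝ) (u : Plane) : Plane →L[ℝ] Plane →L[ℝ] ℝ :=
  fderiv ℝ (fderiv ℝ f) u

/-- `u` is a Morse singularity (nondegenerate critical point) of `f` of index `0` or `2`. In two
variables this means that `u` is critical and that the Hessian is positive definite (index `0`)
or negative definite (index `2`). -/
def IsMorseExtremum (f : Plane → ℝ) (u : Plane) : Prop :=
  fderiv ℝ f u = 0 ∧
    ((∀ w : Plane, w ≠ 0 → 0 < hessian f u w w) ∨ (∀ w : Plane, w ≠ 0 → hessian f u w w < 0))

/-- `S` has contact `A₁⁺` with its tangent plane at `p`: in every local parametrization `x` with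
`x u = p`, the height function `q ↦ ⟨n, q - p⟩` in a direction `n ≠ 0` normal to `T_p S`
(the range of the differential of `x` at `u`) has a Morse singularity of index `0` or `2` at `u`.
The normal direction is unique up to scale, and the linear functionals `⟨n, ·⟩` are the nonzero
functionals with kernel `T_p S`, so using the Euclidean scalar product would give the same notion. -/
def HasContactA1Plus (S : Set Space) (p : Space) : Prop :=
  ∀ (U : Set Plane) (x : Plane → Space), IsLocalParametrization S U x →
    ∀ u ∈ U, x u = p →
      ∀ n : Space, n ≠ 0 → (∀ w : Plane, form n (fderiv ℝ x u w) = 0) →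
        IsMorseExtremum (fun v => form n (x v - p)) u

/-- An ovaloid: a closed surface that has contact `A₁⁺` with its tangent plane at every point. -/
def IsOvaloid (S : Set Space) : Prop :=
  IsClosedSurface S ∧ ∀ p ∈ S, HasContactA1Plus S p

end Minkowski

end

/-!
A translation by a long timelike vector `v` moves the compact ovaloid `S` into the region
`⟨p, p⟩ < 0`, away from the light cone. There the inversion `p ↦ p / ⟨p, p⟩` is a diffeomorphism
and an involution, so that the Möbius inversion of the translate is just its image, and local
parametrizations of `S` and of the image correspond to each other
(`IsLocalParametrization.comp_diffeo`). Hence the image is again a closed surface.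

For the contact with the tangent planes, let `p₀` be a point of the translate. Up to the factor
`⟨p, p⟩`, the height function of the image in a direction `n`, pulled back by the inversion, is
`⟨m, p - p₀⟩ - c ⟨p - p₀, p - p₀⟩`, where `m` is a normal vector at `p₀` and
`c = -⟨m, p₀⟩ / ⟨p₀, p₀⟩` (`form_mul_height_inversion`). Its Hessian is the second fundamental form
in direction `m` minus `2 c` times the first fundamental form. By compactness, the second
fundamental form of an ovaloid is bounded below by `κ ‖m‖ ‖dx w‖²` with a single `κ > 0`
(`IsOvaloid.exists_bound`), whereas `c` is of order `‖m‖ / ‖v‖`. So the Hessian is definite as soon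
as `v` is long enough (`hasContactA1Plus_inversion`, `exists_timelike_translation`).

The bound has to hold in every local parametrization. It passes from one to another because
changes of parameters are smooth (`IsLocalParametrization.exists_transition`) and the Hessian at a
critical point is a tensor (`hessian_comp`).
-/

namespace Minkowski

open Topology Filter Set

/-! ### The pseudo-scalar product -/

/-- The functional `⟨n, ·⟩`. -/
noncomputable def formL (n : Space) : Space →L[ℝ] ℝ :=
  n 0 • EuclideanSpace.proj 0 + n 1 • EuclideanSpace.proj 1 - n 2 • EuclideanSpace.proj 2

@[simp] lemma formL_apply (n p : Space) : formL n p = form n p := by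
  simp [formL, form]

lemma abs_form_le (a b : Space) : |form a b| ≤ 3 * (‖a‖ * ‖b‖) := by
  have h : ∀ i, |a i * b i| ≤ ‖a‖ * ‖b‖ := fun i => by
    rw [abs_mul]
    exact mul_le_mul (PiLp.norm_apply_le a i) (PiLp.norm_apply_le b i) (abs_nonneg _)
      (norm_nonneg _)
  have h0 := abs_le.1 (h 0)
  have h1 := abs_le.1 (h 1)
  have h2 := abs_le.1 (h 2)
  unfold form
  rw [abs_le]
  constructor <;> linarith [h0.1, h0.2, h1.1, h1.2, h2.1, h2.2]

lemma contDiff_form_self : ContDiff ℝ ∞ fun p : Space => form p p := by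
  unfold form
  fun_prop

/-! ### Local parametrizations -/

namespace IsLocalParametrization

variable {S : Set Space} {U : Set Plane} {x : Plane → Space}

lemma mem (h : IsLocalParametrization S U x) {u : Plane} (hu : u ∈ U) : x u ∈ S := by
  obtain ⟨V, -, hV⟩ := h.image_eq
  exact (hV ▸ mem_image_of_mem x hu : x u ∈ S ∩ V).1

lemma contDiffAt (h : IsLocalParametrization S U x) {u : Plane} (hu : u ∈ U) :
    ContDiffAt ℝ ∞ x u :=
  h.contDiffOn.contDiffAt (h.isOpen_domain.mem_nhds hu)

/-- A local parametrization is open onto its image in `S`. -/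
lemma image_mem_nhdsWithin (h : IsLocalParametrization S U x) {u : Plane} (hu : u ∈ U)
    {N : Set Plane} (hN : N ∈ 𝓝 u) : x '' (N ∩ U) ∈ 𝓝[S] (x u) := by
  obtain ⟨V, hVo, hV⟩ := h.image_eq
  have h1 : (Subtype.val ⁻¹' N : Set U) ∈ 𝓝 (⟨u, hu⟩ : U) :=
    continuous_subtype_val.continuousAt hN
  rw [h.isEmbedding.isInducing.nhds_eq_comap, mem_comap] at h1
  obtain ⟨W, hW, hWN⟩ := h1
  have hVu : V ∈ 𝓝 (x u) := hVo.mem_nhds (hV ▸ mem_image_of_mem x hu : x u ∈ S ∩ V).2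
  refine mem_of_superset (inter_mem_nhdsWithin S (inter_mem hVu hW)) ?_
  rintro q ⟨hqS, hqV, hqW⟩
  obtain ⟨v, hv, rfl⟩ : q ∈ x '' U := hV ▸ ⟨hqS, hqV⟩
  exact ⟨v, ⟨hWN (show (⟨v, hv⟩ : U) ∈ _ from hqW), hv⟩, rfl⟩

/-- Two local parametrizations around the same point differ by a smooth change of parameters.
If `P` is a linear left inverse of the differential of `x₁`, then `P ∘ x₁` is a local
diffeomorphism with an inverse `g`, and `g ∘ P ∘ x₂` is the change of parameters. -/
lemma exists_transition {U₁ U₂ : Set Plane} {x₁ x₂ : Plane → Space}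
    (h₁ : IsLocalParametrization S U₁ x₁) (h₂ : IsLocalParametrization S U₂ x₂)
    {u₁ u₂ : Plane} (hu₁ : u₁ ∈ U₁) (hu₂ : u₂ ∈ U₂) (he : x₁ u₁ = x₂ u₂) :
    ∃ φ : Plane → Plane, ContDiffAt ℝ ∞ φ u₂ ∧ φ u₂ = u₁ ∧ x₁ ∘ φ =ᶠ[𝓝 u₂] x₂ := by
  obtain ⟨P₀, hP₀⟩ := LinearMap.exists_leftInverse_of_injective
    (fderiv ℝ x₁ u₁ : Plane →ₗ[ℝ] Space) (LinearMap.ker_eq_bot.2 (h₁.injective_fderiv u₁ hu₁))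
  let P : Space →L[ℝ] Plane := LinearMap.toContinuousLinearMap P₀
  have hs : ContDiffAt ℝ ∞ (P ∘ x₁) u₁ := P.contDiff.contDiffAt.comp u₁ (h₁.contDiffAt hu₁)
  have hd : HasFDerivAt (P ∘ x₁) ((ContinuousLinearEquiv.refl ℝ Plane : Plane ≃L[ℝ] Plane) :
      Plane →L[ℝ] Plane) u₁ := by
    have h := P.hasFDerivAt.comp u₁ ((h₁.contDiffAt hu₁).differentiableAt (by simp)).hasFDerivAt
    have hc : P.comp (fderiv ℝ x₁ u₁) = ContinuousLinearMap.id ℝ Plane :=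
      ContinuousLinearMap.ext fun w => LinearMap.congr_fun hP₀ w
    rw [hc] at h
    exact h
  have hn : (∞ : WithTop ℕ∞) ≠ 0 := by simp
  let g := hs.localInverse hd hn
  have hg : ContDiffAt ℝ ∞ g (P (x₁ u₁)) := hs.to_localInverse hd hn
  have hst := hs.hasStrictFDerivAt' hd hn
  have hleft : ∀ᶠ v in 𝓝 u₁, g (P (x₁ v)) = v := hst.eventually_left_inverse
  have hφ : ContDiffAt ℝ ∞ (g ∘ P ∘ x₂) u₂ := by
    refine ContDiffAt.comp u₂ ?_ (P.contDiff.contDiffAt.comp u₂ (h₂.contDiffAt hu₂))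
    simpa [he] using hg
  refine ⟨g ∘ P ∘ x₂, hφ, ?_, ?_⟩
  · simpa [he] using hleft.self_of_nhds
  · have hx₂ : Tendsto x₂ (𝓝 u₂) (𝓝[S] (x₁ u₁)) := by
      rw [he]
      refine tendsto_nhdsWithin_of_tendsto_nhds_of_eventually_within _
        (h₂.contDiffAt hu₂).continuousAt ?_
      filter_upwards [h₂.isOpen_domain.mem_nhds hu₂] with u hu using h₂.mem hu
    filter_upwards [hx₂ (h₁.image_mem_nhdsWithin hu₁ hleft)] with u hu
    obtain ⟨v, ⟨hv, -⟩, hvu⟩ := hu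
    have hv' : g (P (x₁ v)) = v := hv
    simp only [Function.comp_apply, ← hvu, hv']

/-- Local parametrizations are carried along by a smooth map `ψ` from an open set `Ω ⊇ S` of the
ambient space to an open set `Ω'` on which it has a smooth left inverse `ψ'`. -/
lemma comp_diffeo (h : IsLocalParametrization S U x) {Ω Ω' : Set Space} {ψ ψ' : Space → Space}
    (hΩ : IsOpen Ω) (hΩ' : IsOpen Ω') (hψ : ContDiffOn ℝ ∞ ψ Ω) (hψ' : ContDiffOn ℝ ∞ ψ' Ω')
    (hm : MapsTo ψ Ω Ω') (hinv : ∀ p ∈ Ω, ψ' (ψ p) = p) (hS : S ⊆ Ω) :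
    IsLocalParametrization (ψ '' S) U (ψ ∘ x) where
  isOpen_domain := h.isOpen_domain
  contDiffOn := hψ.comp h.contDiffOn fun _ hu => hS (h.mem hu)
  injective_fderiv u hu := by
    have hxu := hS (h.mem hu)
    have d1 := (hψ.contDiffAt (hΩ.mem_nhds hxu)).differentiableAt (by simp)
    have d2 := (hψ'.contDiffAt (hΩ'.mem_nhds (hm hxu))).differentiableAt (by simp)
    have dx := (h.contDiffAt hu).differentiableAt (by simp)
    have hid : HasFDerivAt (ψ' ∘ ψ) (ContinuousLinearMap.id ℝ Space) (x u) :=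
      (hasFDerivAt_id _).congr_of_eventuallyEq <| by
        filter_upwards [hΩ.mem_nhds hxu] with p hp using hinv p hp
    have hc := (d2.hasFDerivAt.comp (x u) d1.hasFDerivAt).unique hid
    rw [fderiv_comp u d1 dx]
    refine Function.Injective.comp (g := fderiv ℝ ψ (x u)) ?_ (h.injective_fderiv u hu)
    exact Function.LeftInverse.injective (g := fderiv ℝ ψ' (ψ (x u)))
      fun w => DFunLike.congr_fun hc w
  isEmbedding := by
    have hcψ : ∀ u : U, ContinuousAt ψ (x u) := fun u =>
      (hψ.contDiffAt (hΩ.mem_nhds (hS (h.mem u.2)))).continuousAt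
    have hcψ' : ∀ u : U, ContinuousAt ψ' (ψ (x u)) := fun u =>
      (hψ'.contDiffAt (hΩ'.mem_nhds (hm (hS (h.mem u.2))))).continuousAt
    have hx := h.isEmbedding
    have hl : ∀ u : U, ψ' (ψ (x u)) = x u := fun u => hinv _ (hS (h.mem u.2))
    refine ⟨isInducing_iff_nhds.2 fun u => le_antisymm ?_ ?_, ?_⟩
    · exact map_le_iff_le_comap.1
        (ContinuousAt.comp (f := U.domRestrict x) (hcψ u) hx.continuous.continuousAt)
    · rw [hx.isInducing.nhds_eq_comap]
      refine map_le_iff_le_comap.1 ?_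
      have ht : Tendsto (ψ' ∘ U.domRestrict (ψ ∘ x))
          (comap (U.domRestrict (ψ ∘ x)) (𝓝 (U.domRestrict (ψ ∘ x) u))) (𝓝 (ψ' (ψ (x u)))) :=
        (hcψ' u).tendsto.comp tendsto_comap
      rw [hl u] at ht
      exact ht.congr hl
    · intro u v huv
      apply hx.injective
      have : ψ' (ψ (x u)) = ψ' (ψ (x v)) := congrArg ψ' huv
      rwa [hl, hl] at this
  image_eq := by
    obtain ⟨V, hVo, hV⟩ := h.image_eq
    refine ⟨Ω' ∩ ψ' ⁻¹' V, hψ'.continuousOn.isOpen_inter_preimage hΩ' hVo, ?_⟩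
    rw [image_comp, hV]
    ext q
    constructor
    · rintro ⟨p, ⟨hp, hpV⟩, rfl⟩
      exact ⟨mem_image_of_mem ψ hp, hm (hS hp), by simpa [hinv p (hS hp)] using hpV⟩
    · rintro ⟨⟨p, hp, rfl⟩, -, hpV⟩
      exact ⟨p, ⟨hp, by simpa [hinv p (hS hp)] using hpV⟩, rfl⟩

end IsLocalParametrization

/-! ### Hessians -/

lemma hasFDerivAt_fderiv {E : Type*} [NormedAddCommGroup E] [NormedSpace ℝ E]
    {f : Plane → E} {u : Plane} (hf : ContDiffAt ℝ ∞ f u) :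
    HasFDerivAt (fderiv ℝ f) (fderiv ℝ (fderiv ℝ f) u) u :=
  ((hf.fderiv_right (m := ∞) (by simp)).differentiableAt (by simp)).hasFDerivAt

lemma eventually_differentiableAt {E : Type*} [NormedAddCommGroup E] [NormedSpace ℝ E]
    {f : Plane → E} {u : Plane} (hf : ContDiffAt ℝ ∞ f u) : ∀ᶠ v in 𝓝 u, DifferentiableAt ℝ f v :=
  ((hf.of_le (m := 1) (by simp)).eventually (by simp)).mono
    fun _ hv => hv.differentiableAt (by simp)

lemma hessian_congr {f g : Plane → ℝ} {u : Plane} (h : f =ᶠ[𝓝 u] g) :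
    hessian f u = hessian g u :=
  h.fderiv.fderiv_eq

lemma hessian_sub {f g : Plane → ℝ} {u : Plane} (hf : ContDiffAt ℝ ∞ f u)
    (hg : ContDiffAt ℝ ∞ g u) (w : Plane) :
    hessian (fun v => f v - g v) u w w = hessian f u w w - hessian g u w w := by
  have h : fderiv ℝ (fun v => f v - g v) =ᶠ[𝓝 u] fun v => fderiv ℝ f v - fderiv ℝ g v := by
    filter_upwards [eventually_differentiableAt hf, eventually_differentiableAt hg] with v h1 h2
    exact fderiv_fun_sub h1 h2
  unfold hessian
  rw [h.fderiv_eq, ((hasFDerivAt_fderiv hf).fun_sub (hasFDerivAt_fderiv hg)).fderiv]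
  rfl

lemma hessian_mul {f g : Plane → ℝ} {u : Plane} (hf : ContDiffAt ℝ ∞ f u)
    (hg : ContDiffAt ℝ ∞ g u) (w : Plane) :
    hessian (fun v => f v * g v) u w w =
      f u * hessian g u w w + g u * hessian f u w w + 2 * (fderiv ℝ f u w * fderiv ℝ g u w) := by
  have h : fderiv ℝ (fun v => f v * g v) =ᶠ[𝓝 u]
      fun v => f v • fderiv ℝ g v + g v • fderiv ℝ f v := by
    filter_upwards [eventually_differentiableAt hf, eventually_differentiableAt hg] with v h1 h2
    exact fderiv_fun_mul h1 h2
  have df := (hf.differentiableAt (by simp)).hasFDerivAt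
  have dg := (hg.differentiableAt (by simp)).hasFDerivAt
  unfold hessian
  rw [h.fderiv_eq,
    ((df.fun_smul (hasFDerivAt_fderiv hg)).fun_add (dg.fun_smul (hasFDerivAt_fderiv hf))).fderiv]
  simp
  ring

/-- Composition with a continuous affine functional. -/
lemma hessian_clm_sub {E : Type*} [NormedAddCommGroup E] [NormedSpace ℝ E] (L : E →L[ℝ] ℝ)
    {x : Plane → E} {u : Plane} (hx : ContDiffAt ℝ ∞ x u) (p : E) (w : Plane) :
    hessian (fun v => L (x v - p)) u w w = L (fderiv ℝ (fderiv ℝ x) u w w) := by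
  have h : fderiv ℝ (fun v => L (x v - p)) =ᶠ[𝓝 u] fun v => L.comp (fderiv ℝ x v) := by
    filter_upwards [eventually_differentiableAt hx] with v h1
    exact (L.hasFDerivAt.comp v (h1.hasFDerivAt.sub_const p)).fderiv
  unfold hessian
  rw [h.fderiv_eq, ((hasFDerivAt_const L u).clm_comp (hasFDerivAt_fderiv hx)).fderiv]
  simp

/-- At a critical point, the Hessian is a tensor: a change of parameters acts on it through the
differential only. -/
lemma hessian_comp {f : Plane → ℝ} {φ : Plane → Plane} {u : Plane}
    (hf : ContDiffAt ℝ ∞ f (φ u)) (hφ : ContDiffAt ℝ ∞ φ u) (hc : fderiv ℝ f (φ u) = 0)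
    (w : Plane) :
    hessian (f ∘ φ) u w w = hessian f (φ u) (fderiv ℝ φ u w) (fderiv ℝ φ u w) := by
  have h : fderiv ℝ (f ∘ φ) =ᶠ[𝓝 u] fun v => (fderiv ℝ f (φ v)).comp (fderiv ℝ φ v) := by
    filter_upwards [eventually_differentiableAt hφ,
      hφ.continuousAt.eventually (eventually_differentiableAt hf)] with v h1 h2
    exact fderiv_comp v h2 h1
  have dφ := (hφ.differentiableAt (by simp)).hasFDerivAt
  have hd : HasFDerivAt (fun v => fderiv ℝ f (φ v))
      ((fderiv ℝ (fderiv ℝ f) (φ u)).comp (fderiv ℝ φ u)) u := (hasFDerivAt_fderiv hf).comp u dφ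
  unfold hessian
  rw [h.fderiv_eq, (hd.clm_comp (hasFDerivAt_fderiv hφ)).fderiv]
  simp [hc]

/-! ### A uniform lower bound for the second fundamental form -/

lemma continuous_formL : Continuous formL := by
  unfold formL
  fun_prop

/-- Normal vectors `m` at `p` satisfy `κ ‖m‖ ‖dx w‖² ≤ |⟨m, d²x(w, w)⟩|` in every local
parametrization `x` of `S`, that is, the second fundamental form of `S` at `p` is definite with
lower bound `κ` relative to the Euclidean norm. -/
def SecondFormBound (S : Set Space) (κ : ℝ) (p : Space) : Prop :=
  ∀ (U : Set Plane) (x : Plane → Space), IsLocalParametrization S U x → ∀ u ∈ U, x u = p →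
    ∀ m : Space, (∀ w : Plane, form m (fderiv ℝ x u w) = 0) → ∀ w : Plane,
      κ * (‖m‖ * ‖fderiv ℝ x u w‖ ^ 2) ≤ |form m (fderiv ℝ (fderiv ℝ x) u w w)|

lemma SecondFormBound.mono {S : Set Space} {κ κ' : ℝ} {p : Space} (h : SecondFormBound S κ p)
    (hκ : κ' ≤ κ) : SecondFormBound S κ' p := fun U x hx u hu hp m hm w =>
  (mul_le_mul_of_nonneg_right hκ (by positivity)).trans (h U x hx u hu hp m hm w)

lemma hessian_height {x : Plane → Space} {u : Plane} (hx : ContDiffAt ℝ ∞ x u) (m p : Space)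
    (w : Plane) :
    hessian (fun v => form m (x v - p)) u w w = form m (fderiv ℝ (fderiv ℝ x) u w w) := by
  simpa using hessian_clm_sub (formL m) hx p w

lemma fderiv_height {x : Plane → Space} {u : Plane} (hx : ContDiffAt ℝ ∞ x u) (m p : Space)
    (w : Plane) :
    fderiv ℝ (fun v => form m (x v - p)) u w = form m (fderiv ℝ x u w) := by
  have h := ((formL m).hasFDerivAt.comp u
    ((hx.differentiableAt (by simp)).hasFDerivAt.sub_const p)).fderiv
  have h' := DFunLike.congr_fun h w
  simpa [Function.comp_def] using h'

/-- It suffices to test the bound in one local parametrization around `p`. -/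
lemma secondFormBound_of_parametrization {S : Set Space} {κ : ℝ} {U₁ : Set Plane}
    {x₁ : Plane → Space} (h₁ : IsLocalParametrization S U₁ x₁) {u₁ : Plane} (hu₁ : u₁ ∈ U₁)
    (hb : ∀ m : Space, (∀ w : Plane, form m (fderiv ℝ x₁ u₁ w) = 0) → ∀ w : Plane,
      κ * (‖m‖ * ‖fderiv ℝ x₁ u₁ w‖ ^ 2) ≤ |form m (fderiv ℝ (fderiv ℝ x₁) u₁ w w)|) :
    SecondFormBound S κ (x₁ u₁) := by
  intro U₂ x₂ h₂ u₂ hu₂ he m hm w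
  obtain ⟨φ, hφ, hφu, hev⟩ := h₁.exists_transition h₂ hu₁ hu₂ he.symm
  obtain rfl := hφu
  have c1 := h₁.contDiffAt hu₁
  have c2 := h₂.contDiffAt hu₂
  have hd : ∀ w, fderiv ℝ x₂ u₂ w = fderiv ℝ x₁ (φ u₂) (fderiv ℝ φ u₂ w) := fun w => by
    rw [← hev.fderiv_eq, fderiv_comp u₂ (c1.differentiableAt (by simp))
      (hφ.differentiableAt (by simp))]
    rfl
  -- The two parametrizations have the same tangent plane at the point.
  have hinj : Function.Injective (fderiv ℝ φ u₂) := fun a b hab =>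
    h₂.injective_fderiv u₂ hu₂ (by rw [hd, hd, hab])
  have hsurj : Function.Surjective (fderiv ℝ φ u₂) :=
    LinearMap.injective_iff_surjective (f := (fderiv ℝ φ u₂ : Plane →ₗ[ℝ] Plane)).1 hinj
  have hm₁ : ∀ w : Plane, form m (fderiv ℝ x₁ (φ u₂) w) = 0 := fun w => by
    obtain ⟨w', rfl⟩ := hsurj w
    rw [← hd, hm]
  have hcrit : fderiv ℝ (fun v => form m (x₁ v - 0)) (φ u₂) = 0 := by
    ext w
    rw [fderiv_height c1, hm₁]
    rfl
  have hsm : ContDiffAt ℝ ∞ (fun v => form m (x₁ v - 0)) (φ u₂) := by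
    simpa [Function.comp_def] using (formL m).contDiff.contDiffAt.comp (φ u₂) c1
  have hH := hessian_comp hsm hφ hcrit w
  have hev' : (fun v => form m (x₁ v - 0)) ∘ φ =ᶠ[𝓝 u₂] fun v => form m (x₂ v - 0) := by
    filter_upwards [hev] with v hv
    simp only [Function.comp_apply] at hv ⊢
    rw [hv]
  rw [hessian_congr hev', hessian_height c2, hessian_height c1] at hH
  rw [hH, hd]
  exact hb m hm₁ _

lemma form_smul_smul (a b : ℝ) (m p : Space) : form (a • m) (b • p) = a * b * form m p := by
  simp [form]
  ring

/-- Near a point of contact `A₁⁺` the second fundamental form is bounded below uniformly, by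
compactness of the set of parameters, unit vectors `m` and unit directions. Not all of these `m`
are normal; the norm of `⟨m, dx ·⟩` is added to make the minimized function positive. -/
lemma IsLocalParametrization.exists_local_bound {S : Set Space} {U : Set Plane}
    {x : Plane → Space} (h : IsLocalParametrization S U x) (hS : ∀ p ∈ S, HasContactA1Plus S p)
    {u₀ : Plane} (hu₀ : u₀ ∈ U) :
    ∃ κ > 0, ∀ᶠ p in 𝓝[S] (x u₀), SecondFormBound S κ p := by
  obtain ⟨r, hr, hrU⟩ := Metric.nhds_basis_closedBall.mem_iff.1 (h.isOpen_domain.mem_nhds hu₀)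
  set K := Metric.closedBall u₀ r
  have hK : IsCompact K := isCompact_closedBall u₀ r
  have hc1 : ContDiffOn ℝ ∞ (fderiv ℝ x) U :=
    h.contDiffOn.fderiv_of_isOpen h.isOpen_domain (by simp)
  have hc2 : ContDiffOn ℝ ∞ (fderiv ℝ (fderiv ℝ x)) U :=
    hc1.fderiv_of_isOpen h.isOpen_domain (by simp)
  have hk1 : ContinuousOn (fderiv ℝ x) K := hc1.continuousOn.mono hrU
  have hk2 : ContinuousOn (fderiv ℝ (fderiv ℝ x)) K := hc2.continuousOn.mono hrU
  let A : Set (Plane × Space × Plane) := K ×ˢ Metric.sphere 0 1 ×ˢ Metric.sphere 0 1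
  have hA : IsCompact A := hK.prod ((isCompact_sphere 0 1).prod (isCompact_sphere 0 1))
  let Φ : Plane × Space × Plane → ℝ := fun z =>
    |formL z.2.1 (fderiv ℝ (fderiv ℝ x) z.1 z.2.2 z.2.2)| + ‖(formL z.2.1).comp (fderiv ℝ x z.1)‖
  have hΦ : ContinuousOn Φ A := by
    have e1 : ContinuousOn (fun z : Plane × Space × Plane => fderiv ℝ x z.1) A :=
      hk1.comp continuous_fst.continuousOn fun z hz => hz.1
    have e2 : ContinuousOn (fun z : Plane × Space × Plane => fderiv ℝ (fderiv ℝ x) z.1) A :=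
      hk2.comp continuous_fst.continuousOn fun z hz => hz.1
    have e3 : ContinuousOn (fun z : Plane × Space × Plane => formL z.2.1) A :=
      (continuous_formL.comp (continuous_fst.comp continuous_snd)).continuousOn
    have e4 : ContinuousOn (fun z : Plane × Space × Plane => z.2.2) A :=
      (continuous_snd.comp continuous_snd).continuousOn
    exact (e3.clm_apply ((e2.clm_apply e4).clm_apply e4)).abs.add (e3.clm_comp e1).norm
  have hpos : ∀ z ∈ A, 0 < Φ z := by
    rintro ⟨u, m, w⟩ ⟨hu, hm, hw⟩
    have hm0 : m ≠ 0 := Metric.ne_of_mem_sphere hm one_ne_zero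
    have hw0 : w ≠ 0 := Metric.ne_of_mem_sphere hw one_ne_zero
    by_cases hn : (formL m).comp (fderiv ℝ x u) = 0
    · have hn' : ∀ w, form m (fderiv ℝ x u w) = 0 := fun w => by
        simpa using DFunLike.congr_fun hn w
      have hM := (hS (x u) (h.mem (hrU hu)) U x h u (hrU hu) rfl m hm0 hn').2
      have hne : form m (fderiv ℝ (fderiv ℝ x) u w w) ≠ 0 := by
        rw [← hessian_height (h.contDiffAt (hrU hu)) m (x u)]
        rcases hM with hM | hM
        · exact (hM w hw0).ne'
        · exact (hM w hw0).ne
      exact add_pos_of_pos_of_nonneg (abs_pos.2 (by simpa using hne)) (norm_nonneg _)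
    · exact add_pos_of_nonneg_of_pos (abs_nonneg _) (norm_pos_iff.2 hn)
  obtain ⟨κ₀, hκ₀, hmin⟩ := hA.exists_forall_le' hΦ hpos
  obtain ⟨C, hC⟩ := hK.exists_bound_of_continuousOn hk1
  have hC0 : 0 < |C| + 1 := by positivity
  refine ⟨κ₀ / (|C| + 1) ^ 2, by positivity, ?_⟩
  have hnhds : x '' (K ∩ U) ∈ 𝓝[S] (x u₀) :=
    h.image_mem_nhdsWithin hu₀ (Metric.closedBall_mem_nhds u₀ hr)
  filter_upwards [hnhds]
  rintro _ ⟨u, ⟨huK, huU⟩, rfl⟩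
  refine secondFormBound_of_parametrization h huU fun m hm w => ?_
  have hdx : ‖fderiv ℝ x u w‖ ≤ (|C| + 1) * ‖w‖ :=
    (ContinuousLinearMap.le_opNorm _ _).trans <|
      mul_le_mul_of_nonneg_right ((hC u huK).trans ((le_abs_self C).trans (by linarith)))
        (norm_nonneg w)
  have hlow : κ₀ * (‖m‖ * ‖w‖ ^ 2) ≤ |form m (fderiv ℝ (fderiv ℝ x) u w w)| := by
    rcases eq_or_ne m 0 with rfl | hm0
    · simp
    rcases eq_or_ne w 0 with rfl | hw0
    · simp
    have hm1 : ‖m‖ ≠ 0 := norm_ne_zero_iff.2 hm0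
    have hw1 : ‖w‖ ≠ 0 := norm_ne_zero_iff.2 hw0
    have hmem : (u, ‖m‖⁻¹ • m, ‖w‖⁻¹ • w) ∈ A :=
      ⟨huK, by simp [norm_smul, hm1], by simp [norm_smul, hw1]⟩
    have hz : (formL (‖m‖⁻¹ • m)).comp (fderiv ℝ x u) = 0 := by
      ext w
      have := form_smul_smul ‖m‖⁻¹ 1 m (fderiv ℝ x u w)
      simpa [hm] using this
    have := hmin _ hmem
    simp only [Φ, hz, norm_zero, add_zero, map_smul, smul_apply, formL_apply, smul_smul,
      form_smul_smul, abs_mul, abs_inv, abs_norm] at this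
    calc κ₀ * (‖m‖ * ‖w‖ ^ 2) ≤ _ := mul_le_mul_of_nonneg_right this (by positivity)
      _ = _ := by field_simp
  calc κ₀ / (|C| + 1) ^ 2 * (‖m‖ * ‖fderiv ℝ x u w‖ ^ 2)
      ≤ κ₀ / (|C| + 1) ^ 2 * (‖m‖ * ((|C| + 1) * ‖w‖) ^ 2) := by gcongr
    _ = κ₀ * (‖m‖ * ‖w‖ ^ 2) := by field_simp
    _ ≤ _ := hlow

lemma IsOvaloid.exists_bound {S : Set Space} (hS : IsOvaloid S) :
    ∃ κ > 0, ∀ p ∈ S, SecondFormBound S κ p := by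
  obtain ⟨⟨hreg, hcomp, -⟩, hcon⟩ := hS
  refine hcomp.induction_on (p := fun A => ∃ κ > 0, ∀ p ∈ A, SecondFormBound S κ p)
    ⟨1, one_pos, by simp⟩ ?_ ?_ ?_
  · rintro A B hAB ⟨κ, hκ, h⟩
    exact ⟨κ, hκ, fun p hp => h p (hAB hp)⟩
  · rintro A B ⟨κ, hκ, h⟩ ⟨κ', hκ', h'⟩
    refine ⟨min κ κ', lt_min hκ hκ', ?_⟩
    rintro p (hp | hp)
    · exact (h p hp).mono (min_le_left _ _)
    · exact (h' p hp).mono (min_le_right _ _)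
  · intro p hp
    obtain ⟨U, x, hx, u, hu, rfl⟩ := hreg p hp
    obtain ⟨κ, hκ, h⟩ := hx.exists_local_bound hcon hu
    exact ⟨_, h, κ, hκ, fun q hq => hq⟩

/-! ### The inversion -/

/-- The inversion `p ↦ p / ⟨p, p⟩`, an involution off the light cone (with junk value `0` on
it). -/
noncomputable def inversion (p : Space) : Space := (form p p)⁻¹ • p

lemma isOpen_compl_lightCone : IsOpen lightConeᶜ :=
  (isClosed_eq contDiff_form_self.continuous continuous_const).isOpen_compl

lemma contDiffOn_inversion : ContDiffOn ℝ ∞ inversion lightConeᶜ :=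
  (contDiff_form_self.contDiffOn.inv fun _ hp => hp).smul contDiffOn_id

lemma form_inversion_self (p : Space) : form (inversion p) (inversion p) = (form p p)⁻¹ := by
  rw [inversion, form_smul_smul]
  by_cases h : form p p = 0
  · simp [h]
  · field_simp

lemma form_inversion (n p : Space) : form n (inversion p) = (form p p)⁻¹ * form n p := by
  simpa [inversion] using form_smul_smul 1 (form p p)⁻¹ n p

lemma inversion_inversion {p : Space} (hp : p ∈ lightConeᶜ) : inversion (inversion p) = p := by
  have h : form p p ≠ 0 := hp
  rw [inversion, form_inversion_self, inv_inv, inversion, smul_smul, mul_inv_cancel₀ h, one_smul]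

lemma inversion_mem {p : Space} (hp : p ∈ lightConeᶜ) : inversion p ∈ lightConeᶜ := by
  have h : form p p ≠ 0 := hp
  exact fun h0 : form _ _ = 0 => inv_ne_zero h (form_inversion_self p ▸ h0)

lemma mobiusInversion_eq_image {F : Set Space} (hF : IsCompact F) (h : F ⊆ lightConeᶜ) :
    mobiusInversion F = inversion '' F := by
  have hd : F \ lightCone = F :=
    sdiff_eq_self_iff_disjoint.2 (disjoint_left.2 fun p hp hpF => h hpF hp)
  unfold mobiusInversion
  rw [hd]
  exact (hF.image_of_continuousOn (contDiffOn_inversion.continuousOn.mono h)).isClosed.closure_eq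

/-! ### Contact of the inverted surface with its tangent planes -/

lemma contDiffAt_coord {x : Plane → Space} {u : Plane} (hx : ContDiffAt ℝ ∞ x u) (p : Space)
    (i : Fin 3) : ContDiffAt ℝ ∞ (fun v => (x v - p) i) u :=
  (EuclideanSpace.proj i : Space →L[ℝ] ℝ).contDiff.contDiffAt.comp u
    (hx.sub contDiffAt_const)

lemma contDiffAt_form_self {x : Plane → Space} {u : Plane} (hx : ContDiffAt ℝ ∞ x u)
    (p : Space) : ContDiffAt ℝ ∞ (fun v => form (x v - p) (x v - p)) u :=
  contDiff_form_self.contDiffAt.comp u (hx.sub contDiffAt_const)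

lemma contDiffAt_height {x : Plane → Space} {u : Plane} (hx : ContDiffAt ℝ ∞ x u)
    (m p : Space) : ContDiffAt ℝ ∞ (fun v => form m (x v - p)) u := by
  simpa [Function.comp_def] using
    (formL m).contDiff.contDiffAt.comp u (hx.sub (contDiffAt_const (c := p)))

lemma fderiv_form_self {x : Plane → Space} {u : Plane} (hx : ContDiffAt ℝ ∞ x u) :
    fderiv ℝ (fun v => form (x v - x u) (x v - x u)) u = 0 := by
  have h : ∀ i : Fin 3, HasFDerivAt (fun v => (x v - x u) i * (x v - x u) i)
      (0 : Plane →L[ℝ] ℝ) u := fun i => by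
    have hi := ((contDiffAt_coord hx (x u) i).differentiableAt (by simp)).hasFDerivAt
    simpa using hi.fun_mul hi
  simpa [form] using (((h 0).fun_add (h 1)).fun_sub (h 2)).fderiv

lemma hessian_form_self {x : Plane → Space} {u : Plane} (hx : ContDiffAt ℝ ∞ x u) (w : Plane) :
    hessian (fun v => form (x v - x u) (x v - x u)) u w w =
      2 * form (fderiv ℝ x u w) (fderiv ℝ x u w) := by
  have c : ∀ i : Fin 3, ContDiffAt ℝ ∞ (fun v => (x v - x u) i * (x v - x u) i) u := fun i =>
    (contDiffAt_coord hx (x u) i).mul (contDiffAt_coord hx (x u) i)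
  have d : ∀ i : Fin 3, fderiv ℝ (fun v => (x v - x u) i) u w = fderiv ℝ x u w i := fun i => by
    have h := ((EuclideanSpace.proj i : Space →L[ℝ] ℝ).hasFDerivAt.comp u
      ((hx.differentiableAt (by simp)).hasFDerivAt.sub_const (x u))).fderiv
    exact DFunLike.congr_fun h w
  have h : ∀ i : Fin 3, hessian (fun v => (x v - x u) i * (x v - x u) i) u w w =
      2 * (fderiv ℝ x u w i * fderiv ℝ x u w i) := fun i => by
    rw [hessian_mul (contDiffAt_coord hx (x u) i) (contDiffAt_coord hx (x u) i), d i]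
    simp
  have he : (fun v => form (x v - x u) (x v - x u)) = fun v =>
      (x v - x u) 0 * (x v - x u) 0 -
        ((x v - x u) 2 * (x v - x u) 2 - (x v - x u) 1 * (x v - x u) 1) := by
    funext v
    unfold form
    ring
  rw [he, hessian_sub (c 0) ((c 2).sub (c 1)), hessian_sub (c 2) (c 1), h, h, h]
  unfold form
  ring

lemma hessian_const_mul {f : Plane → ℝ} {u : Plane} (hf : ContDiffAt ℝ ∞ f u) (c : ℝ)
    (w : Plane) : hessian (fun v => c * f v) u w w = c * hessian f u w w := by
  rw [hessian_mul contDiffAt_const hf]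
  simp [hessian]

/-- With `p₀` a point off the light cone, `q₀` its inverse, `c = ⟨n, q₀⟩` and `m = n - 2 c p₀`,
the height function in direction `n` at the inverse of `p` is, up to the factor `⟨p, p⟩`, a
quadratic perturbation of the height function in direction `m` at `p`. -/
lemma form_mul_height_inversion {p p₀ : Space} (hp : p ∈ lightConeᶜ) (hp₀ : p₀ ∈ lightConeᶜ)
    (n : Space) :
    form p p * form n (inversion p - inversion p₀) =
      form (n - (2 * form n (inversion p₀)) • p₀) (p - p₀) -
        form n (inversion p₀) * form (p - p₀) (p - p₀) := by
  have h1 : form p p * form n (inversion p) = form n p := by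
    rw [form_inversion, mul_inv_cancel_left₀ hp]
  have h2 : form p₀ p₀ * form n (inversion p₀) = form n p₀ := by
    rw [form_inversion, mul_inv_cancel_left₀ hp₀]
  have h3 : form n (inversion p - inversion p₀) = form n (inversion p) - form n (inversion p₀) := by
    simp only [← formL_apply, map_sub]
  rw [h3, mul_sub, h1]
  generalize form n (inversion p₀) = c at *
  simp only [form, PiLp.sub_apply, PiLp.smul_apply, smul_eq_mul] at h2 ⊢
  linear_combination -h2

/-- The inverted surface has contact `A₁⁺` wherever the second fundamental form of the surface
dominates the perturbation in `form_mul_height_inversion`, whose coefficient satisfies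
`c = -⟨m, p₀⟩ / ⟨p₀, p₀⟩`. -/
lemma hasContactA1Plus_inversion {S : Set Space} {v p : Space} {κ : ℝ}
    (hS : ∀ p ∈ S, p + v ∈ lightConeᶜ) (hp : p ∈ S) (hc : HasContactA1Plus S p)
    (hb : SecondFormBound S κ p) (hκ : 18 * ‖p + v‖ < κ * |form (p + v) (p + v)|) :
    HasContactA1Plus ((fun p => inversion (p + v)) '' S) (inversion (p + v)) := by
  intro U y hy u hu hyu n hn0 hn
  have hT : (fun p => inversion (p + v)) '' S ⊆ lightConeᶜ := by
    rintro _ ⟨p, hp, rfl⟩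
    exact inversion_mem (hS p hp)
  have hΩ : IsOpen {p : Space | p + v ∈ lightConeᶜ} :=
    isOpen_compl_lightCone.preimage (by fun_prop)
  -- A parametrization `y` of the image comes from the parametrization `x` of `S` with
  -- `y = inversion (x + v)`.
  have hx := hy.comp_diffeo (ψ := fun q => inversion q - v) (ψ' := fun p => inversion (p + v))
    isOpen_compl_lightCone hΩ (contDiffOn_inversion.sub contDiffOn_const)
    (contDiffOn_inversion.comp (by fun_prop) fun p hp => hp)
    (fun q hq => by simpa using inversion_mem hq)
    (fun q hq => by simpa using inversion_inversion hq) hT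
  have himg : (fun q => inversion q - v) '' ((fun p => inversion (p + v)) '' S) = S := by
    rw [image_image]
    refine (image_congr fun p hp => ?_).trans (image_id S)
    simp [inversion_inversion (hS p hp)]
  rw [himg] at hx
  set x : Plane → Space := (fun q => inversion q - v) ∘ y with hxdef
  have hxu : x u = p := by simp [hxdef, hyu, inversion_inversion (hS p hp)]
  have hyx : ∀ z ∈ U, y z = inversion (x z + v) := fun z hz => by
    simp [hxdef, inversion_inversion (hT (hy.mem hz))]
  have cx := hx.contDiffAt hu
  have cy := hy.contDiffAt hu
  set p₀ := p + v with hp₀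
  have hp₀c : p₀ ∈ lightConeᶜ := hS p hp
  set c := form n (inversion p₀) with hcdef
  set m := n - (2 * c) • p₀ with hm
  have hD : form p₀ p₀ ≠ 0 := hp₀c
  have hcD : form n p₀ = c * form p₀ p₀ := by
    rw [hcdef, form_inversion]
    field_simp
  have hmp : form m p₀ = -(c * form p₀ p₀) := by
    have : form m p₀ = form n p₀ - 2 * c * form p₀ p₀ := by
      simp only [hm, form, PiLp.sub_apply, PiLp.smul_apply, smul_eq_mul]
      ring
    rw [this, hcD]
    ring
  -- If `m = 0`, then `hmp` forces `c = 0`, hence `n = m = 0`.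
  have hm0 : m ≠ 0 := fun h0 => hn0 <| by
    have hc0 : c = 0 := by
      rw [h0] at hmp
      have : c * form p₀ p₀ = 0 := by
        have : form 0 p₀ = 0 := by simp [form]
        linarith
      exact (mul_eq_zero.1 this).resolve_right hD
    simpa [hm, hc0] using h0
  have cD : ContDiffAt ℝ ∞ (fun z => form (x z - -v) (x z - -v)) u := contDiffAt_form_self cx _
  have cf := contDiffAt_height cy n (inversion p₀)
  have c1 := contDiffAt_height cx m (x u)
  have c2 := contDiffAt_form_self cx (x u)
  have c3 : ContDiffAt ℝ ∞ (fun z => c * form (x z - x u) (x z - x u)) u :=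
    contDiffAt_const.mul c2
  have hev : (fun z => form (x z - -v) (x z - -v) * form n (y z - inversion p₀)) =ᶠ[𝓝 u]
      fun z => form m (x z - x u) - c * form (x z - x u) (x z - x u) := by
    filter_upwards [hy.isOpen_domain.mem_nhds hu] with z hz
    have hz' : x z + v ∈ lightConeᶜ := hS _ (hx.mem hz)
    have := form_mul_height_inversion hz' hp₀c n
    rw [hyx z hz, sub_neg_eq_add, this, hxu, hp₀, add_sub_add_right_eq_sub]
  have hDu : form (x u - -v) (x u - -v) = form p₀ p₀ := by rw [hxu, sub_neg_eq_add]
  have hfu : form n (y u - inversion p₀) = 0 := by simp [hyu, form]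
  have hdf : fderiv ℝ (fun z => form n (y z - inversion p₀)) u = 0 := by
    ext w
    rw [fderiv_height cy, hn, zero_apply]
  -- Comparing first derivatives in `hev` shows that `m` is normal to the original surface at `p`.
  have hmn : ∀ w : Plane, form m (fderiv ℝ x u w) = 0 := fun w => by
    have h := hev.fderiv_eq (𝕜 := ℝ)
    rw [fderiv_fun_mul (cD.differentiableAt (by simp)) (cf.differentiableAt (by simp)),
      fderiv_fun_sub (c1.differentiableAt (by simp)) (c3.differentiableAt (by simp)),
      fderiv_const_mul (c2.differentiableAt (by simp)) c, fderiv_form_self cx, hdf, hfu] at h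
    rw [← fderiv_height cx m (x u)]
    simpa using (DFunLike.congr_fun h w).symm
  have hH : ∀ w : Plane, form p₀ p₀ * hessian (fun z => form n (y z - inversion p₀)) u w w =
      form m (fderiv ℝ (fderiv ℝ x) u w w) -
        2 * c * form (fderiv ℝ x u w) (fderiv ℝ x u w) := fun w => by
    have h := DFunLike.congr_fun (DFunLike.congr_fun (hessian_congr hev) w) w
    rw [hessian_mul cD cf, hessian_sub c1 c3, hessian_const_mul c2, hessian_form_self cx,
      hessian_height cx, hdf, hfu, hDu] at h
    simp only [zero_mul, zero_apply, mul_zero, add_zero] at h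
    rw [h]
    ring
  have hlt : ∀ w : Plane, w ≠ 0 → |2 * c * form (fderiv ℝ x u w) (fderiv ℝ x u w)| <
      |form m (fderiv ℝ (fderiv ℝ x) u w w)| := fun w hw => by
    have hdx : fderiv ℝ x u w ≠ 0 := fun h0 =>
      hw (hx.injective_fderiv u hu (h0.trans (map_zero _).symm))
    have hN : 0 < ‖m‖ * ‖fderiv ℝ x u w‖ ^ 2 := by positivity
    have hcb : |c| * |form p₀ p₀| ≤ 3 * (‖m‖ * ‖p₀‖) := by
      rw [← abs_mul, ← abs_neg, ← hmp]
      exact abs_form_le m p₀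
    have hR := abs_form_le (fderiv ℝ x u w) (fderiv ℝ x u w)
    have hQ := hb U x hx u hu hxu m hmn w
    refine lt_of_mul_lt_mul_right ?_ (abs_nonneg (form p₀ p₀))
    calc |2 * c * form (fderiv ℝ x u w) (fderiv ℝ x u w)| * |form p₀ p₀|
        = 2 * ((|c| * |form p₀ p₀|) * |form (fderiv ℝ x u w) (fderiv ℝ x u w)|) := by
          rw [abs_mul, abs_mul, abs_two]
          ring
      _ ≤ 2 * ((3 * (‖m‖ * ‖p₀‖)) * (3 * (‖fderiv ℝ x u w‖ * ‖fderiv ℝ x u w‖))) := by gcongr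
      _ = 18 * ‖p₀‖ * (‖m‖ * ‖fderiv ℝ x u w‖ ^ 2) := by ring
      _ < κ * |form p₀ p₀| * (‖m‖ * ‖fderiv ℝ x u w‖ ^ 2) := by gcongr
      _ = κ * (‖m‖ * ‖fderiv ℝ x u w‖ ^ 2) * |form p₀ p₀| := by ring
      _ ≤ _ := by gcongr
  have hM := (hc U x hx u hu hxu m hm0 hmn).2
  simp only [hessian_height cx] at hM
  refine ⟨hdf, ?_⟩
  -- The sign of the Hessian is that of the second fundamental form, times the sign of `⟨p₀, p₀⟩`.
  have hsign : (∀ w : Plane, w ≠ 0 →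
      0 < form p₀ p₀ * hessian (fun z => form n (y z - inversion p₀)) u w w) ∨
      ∀ w : Plane, w ≠ 0 →
        form p₀ p₀ * hessian (fun z => form n (y z - inversion p₀)) u w w < 0 := by
    refine hM.imp (fun h w hw => ?_) fun h w hw => ?_
    · have h1 := hlt w hw
      rw [abs_of_pos (h w hw)] at h1
      rw [hH w]
      linarith [le_abs_self (2 * c * form (fderiv ℝ x u w) (fderiv ℝ x u w))]
    · have h1 := hlt w hw
      rw [abs_of_neg (h w hw)] at h1
      rw [hH w]
      linarith [neg_abs_le (2 * c * form (fderiv ℝ x u w) (fderiv ℝ x u w))]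
  rcases lt_or_gt_of_ne hD with hneg | hpos
  · exact hsign.symm.imp (fun h w hw => pos_of_mul_neg_right (h w hw) hneg.le)
      fun h w hw => neg_of_mul_pos_right (h w hw) hneg.le
  · exact hsign.imp (fun h w hw => pos_of_mul_pos_right (h w hw) hpos.le)
      fun h w hw => neg_of_mul_neg_right (h w hw) hpos.le

/-! ### Translating the surface far into the timelike cone -/

/-- The negative of `⟨p + v, p + v⟩` grows quadratically in the length of a timelike translation
`v`, and `‖p + v‖` only linearly. -/
lemma exists_timelike_translation {S : Set Space} (hS : IsCompact S) {κ : ℝ} (hκ : 0 < κ) :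
    ∃ v : Space, ∀ p ∈ S, p + v ∈ lightConeᶜ ∧
      18 * ‖p + v‖ < κ * |form (p + v) (p + v)| := by
  obtain ⟨R, hR⟩ := hS.isBounded.exists_norm_le
  set t : ℝ := 16 * (|R| + 1) + 144 / κ with ht
  have hR0 := abs_nonneg R
  have hκ' : 0 < 144 / κ := by positivity
  have htR : 16 * (|R| + 1) < t := by linarith
  have hκt : 144 < κ * t := by
    have : κ * (144 / κ) = 144 := by field_simp
    nlinarith
  have ht0 : 0 < t := by linarith
  -- With this `t`, `‖p + v‖ ≤ 2 t` and `⟨p + v, p + v⟩ ≤ -t² / 4` on `S`, and `144 < κ t`.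
  refine ⟨EuclideanSpace.single 2 t, fun p hp => ?_⟩
  have hpR : ‖p‖ ≤ |R| := (hR p hp).trans (le_abs_self R)
  have hnorm : ‖p + EuclideanSpace.single 2 t‖ ≤ 2 * t := by
    refine (norm_add_le _ _).trans ?_
    rw [PiLp.norm_single, Real.norm_of_nonneg ht0.le]
    linarith
  have he : form (p + EuclideanSpace.single 2 t) (p + EuclideanSpace.single 2 t) =
      form p p - 2 * t * p 2 - t ^ 2 := by
    simp [form]
    ring
  have h1 : form p p ≤ 3 * (|R| * |R|) :=
    (le_abs_self _).trans ((abs_form_le p p).trans (by gcongr))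
  have h2 : -|R| ≤ p 2 := (abs_le.1 ((PiLp.norm_apply_le p 2).trans hpR)).1
  have h3 : form (p + EuclideanSpace.single 2 t) (p + EuclideanSpace.single 2 t) ≤ -(t ^ 2 / 4) := by
    rw [he]
    nlinarith
  have h4 : t ^ 2 / 4 ≤ |form (p + EuclideanSpace.single 2 t) (p + EuclideanSpace.single 2 t)| :=
    (by linarith : t ^ 2 / 4 ≤ -form _ _).trans (neg_le_abs _)
  have h5 : 0 < t ^ 2 / 4 := by positivity
  refine ⟨fun h0 : form _ _ = 0 => by linarith, ?_⟩
  calc 18 * ‖p + EuclideanSpace.single 2 t‖ ≤ 144 * t / 4 := by linarith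
    _ < κ * t * t / 4 := by gcongr
    _ = κ * (t ^ 2 / 4) := by ring
    _ ≤ _ := by gcongr

end Minkowski

open Minkowski Set in
theorem mainTheorem1 (S : Set Minkowski.Space) (hS : Minkowski.IsOvaloid S) :
    ∃ v : Minkowski.Space,
      Minkowski.IsOvaloid (Minkowski.mobiusInversion ((fun p : Minkowski.Space => p + v) '' S)) := by
  obtain ⟨κ, hκ, hb⟩ := hS.exists_bound
  obtain ⟨⟨hreg, hcomp, hconn⟩, hcon⟩ := hS
  obtain ⟨v, hv⟩ := exists_timelike_translation hcomp hκ
  have hcont : ContDiffOn ℝ ∞ (fun p => inversion (p + v)) {p : Space | p + v ∈ lightConeᶜ} :=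
    contDiffOn_inversion.comp (by fun_prop) fun p hp => hp
  have hsub : S ⊆ {p : Space | p + v ∈ lightConeᶜ} := fun p hp => (hv p hp).1
  refine ⟨v, ?_⟩
  rw [mobiusInversion_eq_image (hcomp.image (by fun_prop))
    (by rintro _ ⟨p, hp, rfl⟩; exact hsub hp), image_image]
  have hc := hcont.continuousOn.mono hsub
  refine ⟨⟨?_, hcomp.image_of_continuousOn hc, hconn.image _ hc⟩, ?_⟩
  · rintro _ ⟨p, hp, rfl⟩
    obtain ⟨U, x, hx, u, hu, rfl⟩ := hreg p hp
    refine ⟨U, _, hx.comp_diffeo (ψ' := fun q => inversion q - v)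
      (isOpen_compl_lightCone.preimage (by fun_prop)) isOpen_compl_lightCone hcont
      (contDiffOn_inversion.sub contDiffOn_const) (fun p hp => inversion_mem hp)
      (fun p hp => ?_) hsub, u, hu, rfl⟩
    simp [inversion_inversion (show p + v ∈ lightConeᶜ from hp)]
  · rintro _ ⟨p, hp, rfl⟩
    exact hasContactA1Plus_inversion hsub hp (hcon p hp) (hb p hp) (hv p hp).2
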